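/- Let $\mathfrak g$ be a finite-dimensional simple Lie algebra over a field $K$ of characteristic zero, $\mathfrak t$ a splitting Cartan subalgebra of $\mathfrak g$ (if $K$ is algebraically closed, any Cartan subalgebra), and $\Delta\subset\mathfrak t^*$ the root system of $(\mathfrak g,\mathfrak t)$. Write $\mathrm{rk}\,\mathfrak g=\dim_K\mathfrak t$. Let $\Pi=\{\alpha_1,\dots,\alpha_p\}$ be a base (a set of simple roots) of $\Delta$, let $\Delta^+$ be the corresponding set of positive roots, and put $Q^+=\{\sum_{i=1}^p n_i\alpha_i : n_i\in\mathbb Z_{\ge 0}\}$. Partially order $\Delta^+$ by $\mu\preccurlyeq\nu$ if and only if $\nu-\mu\in Q^+$. Let $\Gamma\subset\Delta^+$ be an antichain, that is, no two distinct elements of $\Gamma$ are comparable. Then: (i) the elements of $\Gamma$ are linearly independent (over $K$, in $\mathfrak t^*$), and hence $\#\Gamma\le\mathrm{rk}\,\mathfrak g$; (ii) if $\#\Gamma=\mathrm{rk}\,\mathfrak g$, then $\Gamma=\Pi$. -/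

import Mathlib

namespace RootPoset

variable {ι R M N : Type*} [CommRing R] [AddCommGroup M] [Module R M] [AddCommGroup N] [Module R N]
  {P : RootPairing ι R M N}

/-- The additive monoid `Q⁺` of all sums `∑ nᵢ αᵢ` with natural number coefficients `nᵢ`, where the
`αᵢ` are the simple roots (the elements of the base `b`). -/
def posMonoid (b : P.Base) : AddSubmonoid M :=
  AddSubmonoid.closure (P.root '' b.support)

/-- The standard partial order on (indices of) roots: `μ ≼ ν` if and only if `ν - μ ∈ Q⁺`. -/
def rootLE (b : P.Base) (μ ν : ι) : Prop :=
  P.root ν - P.root μ ∈ posMonoid b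

end RootPoset

/-! ### Non-acute families of positive roots. -/

namespace RootPairing.Base

variable {ι R M N : Type*} [Finite ι] [Field R] [CharZero R] [AddCommGroup M] [Module R M]
  [AddCommGroup N] [Module R N] {P : RootPairing ι R M N} [P.IsRootSystem] [P.IsCrystallographic]
  {b : P.Base}

open Set Submodule

/-! (i) If two distinct roots form an acute angle, their difference is a root, so they are
comparable. Hence an antichain is pairwise non-acute; lying in the half-space of positive height, it
is linearly independent.

(ii) Let `e` be the sum of simple root vectors and `J` the set of positive roots not strictly above
any element of `Γ`. By `sl₂`-theory `ad e` is injective on the span of the `f β`, `β ∈ J`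
(`eq_zero_of_lie_principal_sum_eq_zero`), and it maps this span into `T = H + span {f β | β ∈ J \
Γ}` (`lie_principal_f_mem`). If `#Γ` is the rank, then `dim T ≤ #J`, so the image is all of `T`. A
simple `α ∉ Γ` would give `f α ∈ T ⊆ im (ad e)`, which is Killing-orthogonal to `e`, whereas `e` and
`f α` pair nontrivially. Hence `Π ⊆ Γ`, and cardinalities agree. -/

/-- Positive roots which pairwise subtend non-acute angles are linearly independent. -/
lemma linearIndepOn_root_of_pairwise_nonpos {s : Set ι} (hs : ∀ i ∈ s, b.IsPos i)
    (hn : s.Pairwise fun i j ↦ P.pairingIn ℤ i j ≤ 0) :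
    LinearIndepOn R P.root s := by
  have : Fintype ι := Fintype.ofFinite ι
  -- `R` carries no order, so the positivity argument takes place in the root lattice over `ℤ`; the
  -- base is a basis both there and over `R`, which transfers independence.
  let v (i : s) : P.rootSpan ℤ := P.rootSpanMem ℤ i
  let f : Module.Dual ℤ (P.rootSpan ℤ) := b.toWeightBasisInt.constr ℤ fun _ ↦ (1 : ℤ)
  have hf (i : ι) : f (P.rootSpanMem ℤ i) = b.height i := by
    obtain ⟨g, -, -, hg⟩ := b.exists_root_eq_sum_int i
    have : P.rootSpanMem ℤ i = ∑ j : b.support, g j • b.toWeightBasisInt j := by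
      ext
      simp only [Submodule.coe_sum, Submodule.coe_smul, coe_toWeightBasisInt_apply]
      rw [Finset.sum_coe_sort b.support fun j ↦ g j • P.root j, ← hg]
    rw [this, height_eq_sum hg, map_sum, ← Finset.sum_coe_sort b.support]
    exact Finset.sum_congr rfl fun j _ ↦ by
      rw [map_smul, Module.Basis.constr_basis, smul_eq_mul, mul_one]
  have hp : ∀ i, 0 < f (v i) := fun i ↦ by
    rw [hf]
    exact hs i i.2
  obtain ⟨B, hB⟩ : ∃ B : P.RootPositiveForm ℤ, B.posForm.toQuadraticMap.PosDef :=
    ⟨P.posRootForm ℤ, by simpa using P.posRootForm_rootFormIn_posDef ℤ⟩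
  have hn' : Pairwise fun i j : s ↦ B.posForm (v i) (v j) ≤ 0 := by
    rintro ⟨i, hi⟩ ⟨j, hj⟩ hij
    refine (B.posForm_apply_root_root_le_zero_iff i j).mpr ?_
    exact hn hi hj (by simpa using hij)
  have hv := LinearMap.BilinForm.linearIndependent_of_pairwise_le_zero B.posForm hB f v hp hn'
  have hv' : LinearIndependent ℤ fun i ↦ b.toWeightBasisInt.equivFun (v i) :=
    hv.map' _ (LinearEquiv.ker _)
  have hv'' := (linearIndependent_algebraMap_comp_iff (R := ℤ) (S := R)).mpr hv'
  have key (i : s) : b.toWeightBasis.equivFun.symm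
      (algebraMap ℤ R ∘ b.toWeightBasisInt.equivFun (v i)) = P.root i := by
    have h := congr_arg (Subtype.val) (b.toWeightBasisInt.sum_equivFun (v i))
    rw [Module.Basis.equivFun_symm_apply]
    simp only [Submodule.coe_sum, Submodule.coe_smul, coe_toWeightBasisInt_apply] at h
    simp only [Function.comp_apply, toWeightBasis_apply, eq_intCast, Int.cast_smul_eq_zsmul]
    exact h
  have hroot : (fun i : s ↦ P.root i) = b.toWeightBasis.equivFun.symm.toLinearMap ∘
      fun i ↦ algebraMap ℤ R ∘ b.toWeightBasisInt.equivFun (v i) := funext fun i ↦ (key i).symm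
  change LinearIndependent R fun i : s ↦ P.root i
  rw [hroot]
  exact hv''.map' _ (LinearEquiv.ker _)

end RootPairing.Base

/-! ### Heights and antichains in the root poset. -/

namespace RootPoset

variable {ι R M N : Type*} [CommRing R] [AddCommGroup M] [Module R M]
  [AddCommGroup N] [Module R N] {P : RootPairing ι R M N} {b : P.Base}

lemma exists_eq_sum_of_mem_posMonoid {x : M} (hx : x ∈ posMonoid b) :
    ∃ f : ι → ℕ, x = ∑ j ∈ b.support, f j • P.root j := by
  classical
  induction hx using AddSubmonoid.closure_induction with
  | mem x hx =>
    obtain ⟨j, hj, rfl⟩ := hx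
    refine ⟨Pi.single j 1, ?_⟩
    rw [Finset.sum_eq_single_of_mem j hj (by simp +contextual)]
    simp
  | zero => exact ⟨0, by simp⟩
  | add x y _ _ hx hy =>
    obtain ⟨f, rfl⟩ := hx
    obtain ⟨g, rfl⟩ := hy
    exact ⟨f + g, by simp [add_smul, Finset.sum_add_distrib]⟩

variable [CharZero R]

lemma rootLE.height_le_and {i j : ι} (h : rootLE b i j) :
    b.height i ≤ b.height j ∧ (b.height i = b.height j → i = j) := by
  obtain ⟨f, hf⟩ := exists_eq_sum_of_mem_posMonoid h
  obtain ⟨g, -, -, hg⟩ := b.exists_root_eq_sum_int i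
  have hj : P.root j = ∑ k ∈ b.support, (g k + f k) • P.root k := by
    rw [sub_eq_iff_eq_add'] at hf
    simp only [hf, add_smul, Finset.sum_add_distrib, ← hg, natCast_zsmul]
  have hsum : b.height j = b.height i + ∑ k ∈ b.support, (f k : ℤ) := by
    rw [RootPairing.Base.height_eq_sum hg, RootPairing.Base.height_eq_sum hj,
      Finset.sum_add_distrib]
  refine ⟨by rw [hsum]; exact le_add_of_nonneg_right (by positivity), fun hij ↦ ?_⟩
  have h0 : ∑ k ∈ b.support, (f k : ℤ) = 0 := by lia
  rw [Finset.sum_eq_zero_iff_of_nonneg (by simp)] at h0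
  have : P.root j - P.root i = 0 := by
    rw [hf]
    exact Finset.sum_eq_zero fun k hk ↦ by simp [Int.natCast_eq_zero.mp (h0 k hk)]
  exact P.root.injective (sub_eq_zero.mp this).symm

lemma rootLE.eq_of_mem_support {i j : ι} (h : rootLE b i j) (hi : b.IsPos i)
    (hj : j ∈ b.support) : i = j := by
  have h1 := h.height_le_and
  rw [RootPairing.Base.height_one_of_mem_support hj] at h1
  rw [RootPairing.Base.isPos_iff] at hi
  exact h1.2 (by lia)

lemma root_mem_posMonoid_of_isPos {i : ι} (hi : b.IsPos i) : P.root i ∈ posMonoid b := by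
  obtain ⟨f, -, hf | hf⟩ := b.exists_root_eq_sum_nat_or_neg i
  · rw [hf]
    exact sum_mem fun j hj ↦ nsmul_mem (AddSubmonoid.subset_closure (Set.mem_image_of_mem _ hj)) _
  · have h : P.root i = ∑ j ∈ b.support, (-(f j : ℤ)) • P.root j := by
      simp [hf]
    have := RootPairing.Base.height_eq_sum h
    rw [RootPairing.Base.isPos_iff, this, Finset.sum_neg_distrib, Left.neg_pos_iff] at hi
    exact absurd hi (not_lt.mpr (by positivity))

/-- Distinct elements of an antichain subtend non-acute angles. -/
lemma pairingIn_nonpos_of_isAntichain {R : Type*} [Field R] [CharZero R] [Module R M] [Module R N]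
    [Finite ι] {P : RootPairing ι R M N} [P.IsCrystallographic] {b : P.Base} {s : Set ι}
    (hs : IsAntichain (rootLE b) s) : s.Pairwise fun i j ↦ P.pairingIn ℤ i j ≤ 0 := by
  intro i hi j hj hij
  by_contra! h
  obtain ⟨k, hk⟩ := P.root_sub_root_mem_of_pairingIn_pos h hij
  -- Whichever sign the root `i - j` has, `i` and `j` are comparable.
  let := P.indexNeg
  rcases RootPairing.Base.IsPos.or_neg b k with hk' | hk'
  · refine hs hj hi hij.symm ?_
    rw [rootLE, ← hk]
    exact root_mem_posMonoid_of_isPos hk'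
  · refine hs hi hj hij ?_
    have := root_mem_posMonoid_of_isPos hk'
    rwa [P.indexNeg_neg, P.root_reflectionPerm, P.reflection_apply_self, hk, neg_sub] at this

end RootPoset

/-! ### The principal `sl₂`-triple. -/

namespace LieAlgebra.IsKilling

open LieModule Module

variable {K L : Type*} [Field K] [CharZero K] [LieRing L] [LieAlgebra K L]
  [IsKilling K L] [FiniteDimensional K L]
  {H : LieSubalgebra K L} [H.IsCartanSubalgebra] [IsTriangularizable K H L]

/-- A choice, for every root `α`, of an `sl₂`-triple made of the coroot of `α` and root vectors for
`α` and `-α`. -/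
structure RootVectors (H : LieSubalgebra K L) [H.IsCartanSubalgebra] [IsTriangularizable K H L] where
  /-- The root vector for `α`. -/
  e : H.root → L
  /-- The root vector for `-α`. -/
  f : H.root → L
  isSl2Triple (α : H.root) : IsSl2Triple (coroot (α : Weight K H L) : L) (e α) (f α)
  e_mem (α : H.root) : e α ∈ rootSpace H (α : Weight K H L)
  f_mem (α : H.root) : f α ∈ rootSpace H (-(α : Weight K H L))

lemma nonempty_rootVectors : Nonempty (RootVectors H) := by
  choose h e f ht he hf using fun α : H.root ↦
    exists_isSl2Triple_of_weight_isNonZero (H.isNonZero_coe_root α)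
  refine ⟨e, f, fun α ↦ ?_, he, hf⟩
  rw [← (ht α).h_eq_coroot (H.isNonZero_coe_root α) (he α) (hf α)]
  exact ht α

lemma lie_eq_smul_of_mem_rootSpace' {α : H → K} {y : L} (hy : y ∈ rootSpace H α) (x : H) :
    ⁅(x : L), y⁆ = α x • y :=
  lie_eq_smul_of_mem_rootSpace hy x

/-- The element is `2ρ^∨`, determined by taking the value 2 on every simple root. -/
lemma exists_apply_eq_two_mul_height (b : (rootSystem H).Base) :
    ∃ x : H, ∀ α : H.root, (α : Weight K H L) x = 2 * (b.height α : K) := by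
  let φ : Dual K (Dual K H) := b.toWeightBasis.constr K fun _ ↦ (2 : K)
  refine ⟨(evalEquiv K H).symm φ, fun α ↦ ?_⟩
  have hφ (ψ : Dual K H) : ψ ((evalEquiv K H).symm φ) = φ ψ := by
    rw [apply_evalEquiv_symm_apply]
  have hsimple : ∀ j ∈ b.support, φ ((rootSystem H).root j) = 2 := fun j hj ↦ by
    have := b.toWeightBasis.constr_basis K (fun _ ↦ (2 : K)) ⟨j, hj⟩
    rwa [RootPairing.Base.toWeightBasis_apply] at this
  obtain ⟨g, -, -, hg⟩ := b.exists_root_eq_sum_int α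
  have h := hφ ((rootSystem H).root α)
  rw [rootSystem_root_apply, Weight.toLinear_apply] at h
  rw [h, ← rootSystem_root_apply, RootPairing.Base.height_eq_sum hg, hg, map_sum, Int.cast_sum,
    Finset.mul_sum]
  refine Finset.sum_congr rfl fun j hj ↦ ?_
  rw [map_zsmul, hsimple j hj, zsmul_eq_mul, mul_comm]

lemma rootSpace_sub_eq_bot (b : (rootSystem H).Base) {α β : H.root} (hα : α ∈ b.support)
    (hβ : β ∈ b.support) (hne : α ≠ β) :
    rootSpace H ((α : Weight K H L) + -(β : Weight K H L) : H → K) = ⊥ := by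
  by_contra hbot
  let W : Weight K H L := ⟨_, hbot⟩
  have hW : (W.toLinear : Dual K H) = (rootSystem H).root α - (rootSystem H).root β := by
    ext x
    simp [W, sub_eq_add_neg]
  have hW0 : W.IsNonZero := fun h0 ↦ by
    rw [(Weight.coe_toLinear_eq_zero_iff).mpr h0, eq_comm, sub_eq_zero] at hW
    exact hne ((rootSystem H).root.injective hW)
  exact b.sub_notMem_range_root hα hβ ⟨⟨W, by simpa [LieSubalgebra.root] using hW0⟩, hW⟩

namespace RootVectors

variable (v : RootVectors H) (b : (rootSystem H).Base)

/-- The principal nilpotent element: the sum of the simple root vectors. -/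
def principal : L := ∑ α ∈ b.support, v.e α

lemma lie_e_f_of_ne {α β : H.root} (hα : α ∈ b.support) (hβ : β ∈ b.support) (hne : α ≠ β) :
    ⁅v.e α, v.f β⁆ = 0 := by
  have h : ⁅v.e α, v.f β⁆ ∈ rootSpace H ((α : Weight K H L) + -(β : Weight K H L) : H → K) :=
    lie_mem_genWeightSpace_of_mem_genWeightSpace (v.e_mem α) (v.f_mem β)
  rwa [rootSpace_sub_eq_bot b hα hβ hne, LieSubmodule.mem_bot] at h

/-- The principal nilpotent element belongs to an `sl₂`-triple whose semisimple element acts on a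
root vector as twice the height of the root. -/
lemma exists_isSl2Triple_principal [Nonempty H.root] :
    ∃ (x : H) (y : L), IsSl2Triple (x : L) (v.principal b) y ∧
      ∀ α : H.root, (α : Weight K H L) x = 2 * (b.height α : K) := by
  classical
  obtain ⟨x, hx⟩ := exists_apply_eq_two_mul_height b
  have hx' : ∀ α ∈ b.support, (α : Weight K H L) x = 2 := fun α hα ↦ by
    rw [hx, RootPairing.Base.height_one_of_mem_support hα]
    simp
  let c := b.toCoweightBasis.repr x
  let c' (α : H.root) : K := if h : α ∈ b.support then c ⟨α, h⟩ else 0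
  have hc : x = ∑ α ∈ b.support, c' α • coroot (α : Weight K H L) := by
    conv_lhs => rw [← b.toCoweightBasis.sum_repr x]
    rw [← Finset.sum_coe_sort b.support]
    refine Finset.sum_congr rfl fun α _ ↦ ?_
    simp [c', c]
  -- Cross brackets of simple root vectors vanish, so weighting `f α` by the coroot coordinates of
  -- `x` makes the bracket with `e` equal to `x`.
  refine ⟨x, ∑ α ∈ b.support, c' α • v.f α, ⟨?_, ?_, ?_, ?_⟩, hx⟩
  · obtain ⟨α, hα⟩ := b.support_nonempty
    intro h0
    have := hx' α hα
    rw [(ZeroMemClass.coe_eq_zero).mp h0, ← Weight.toLinear_apply, map_zero] at this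
    exact two_ne_zero this.symm
  · rw [principal, sum_lie]
    have hc' : (x : L) = ∑ α ∈ b.support, c' α • (coroot (α : Weight K H L) : L) := by
      conv_lhs => rw [hc]
      simp
    rw [hc']
    refine Finset.sum_congr rfl fun α hα ↦ ?_
    rw [lie_sum, Finset.sum_eq_single_of_mem α hα]
    · rw [lie_smul, (v.isSl2Triple α).lie_e_f]
    · intro β hβ hne
      rw [lie_smul, v.lie_e_f_of_ne b hα hβ hne.symm, smul_zero]
  · rw [principal, lie_sum, Finset.smul_sum]
    refine Finset.sum_congr rfl fun α hα ↦ ?_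
    rw [lie_eq_smul_of_mem_rootSpace' (v.e_mem α), hx' α hα, ofNat_smul_eq_nsmul]
  · rw [lie_sum, Finset.smul_sum, ← Finset.sum_neg_distrib]
    refine Finset.sum_congr rfl fun α hα ↦ ?_
    rw [lie_smul, lie_eq_smul_of_mem_rootSpace' (v.f_mem α), Pi.neg_apply, hx' α hα, neg_smul,
      smul_neg, smul_comm, ofNat_smul_eq_nsmul]

/-- The principal nilpotent element acts injectively on the sum of the negative root spaces. -/
lemma eq_zero_of_lie_principal_sum_eq_zero {J : Finset H.root} (hJ : ∀ β ∈ J, b.IsPos β)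
    (c : H.root → K) (hc : ⁅v.principal b, ∑ β ∈ J, c β • v.f β⁆ = 0) : ∀ β ∈ J, c β = 0 := by
  classical
  intro β₀ hβ₀
  have : Nonempty H.root := ⟨β₀⟩
  obtain ⟨x, y, ht, hx⟩ := v.exists_isSl2Triple_principal b
  let w (k : ℤ) : L := ∑ β ∈ J with b.height β = k, c β • v.f β
  have hxw (k : ℤ) : ⁅(x : L), w k⁆ = (-2 * k : K) • w k := by
    simp only [w]
    rw [lie_sum, Finset.smul_sum]
    refine Finset.sum_congr rfl fun β hβ ↦ ?_
    rw [lie_smul, lie_eq_smul_of_mem_rootSpace' (v.f_mem β), Pi.neg_apply, hx,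
      (Finset.mem_filter.mp hβ).2, smul_comm, neg_mul]
  -- The brackets have `ad x`-eigenvalues `2 - 2k`, distinct for distinct `k`, so each vanishes once
  -- their sum does.
  have hew : ∀ k ∈ J.image b.height, ⁅v.principal b, w k⁆ = 0 := by
    have hind := (ad K L (x : L)).eigenspaces_iSupIndep.comp
      (f := fun k : ℤ ↦ (2 - 2 * k : K)) fun k l hkl ↦ by simpa using hkl
    rw [iSupIndep_iff_finsetSum_eq_zero_imp_eq_zero] at hind
    refine hind (J.image b.height) (fun k ↦ ⁅v.principal b, w k⁆) (fun k _ ↦ ?_) ?_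
    · rw [Function.comp_apply, End.mem_eigenspace_iff, ad_apply, leibniz_lie, hxw, lie_smul,
        ht.lie_h_e_nsmul, nsmul_lie, ← ofNat_smul_eq_nsmul K, ← add_smul]
      congr 1
      ring
    · rw [← lie_sum, Finset.sum_fiberwise_of_maps_to
        (fun β hβ ↦ Finset.mem_image_of_mem _ hβ), hc]
  have hw : w (b.height β₀) = 0 := by
    by_contra hne
    -- A nonzero vector killed by `e` is primitive, so its weight `-2k` would be a natural number,
    -- contradicting `k > 0`.
    obtain ⟨n, hn⟩ := IsSl2Triple.HasPrimitiveVectorWith.exists_nat (t := ht)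
      ⟨hne, hxw _, hew _ (Finset.mem_image_of_mem _ hβ₀)⟩
    have hpos := hJ β₀ hβ₀
    rw [RootPairing.Base.isPos_iff] at hpos
    have : (-2 * b.height β₀ : ℤ) = n := by exact_mod_cast hn
    lia
  have hind := (iSupIndep_genWeightSpace K H L).comp
    (f := fun β : H.root ↦ (-(β : Weight K H L) : H → K)) fun α β h ↦ by
      exact Subtype.ext (DFunLike.coe_injective (neg_injective h))
  rw [← LieSubmodule.iSupIndep_toSubmodule, iSupIndep_iff_finsetSum_eq_zero_imp_eq_zero] at hind
  have h0 := hind _ (fun β ↦ c β • v.f β) (fun β _ ↦ Submodule.smul_mem _ _ (v.f_mem β)) hw β₀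
    (by simp [hβ₀])
  exact (smul_eq_zero.mp h0).resolve_right (v.isSl2Triple β₀).f_ne_zero

/-- Only the summand `e α` of `e` pairs with `f α`; by invariance of the form this keeps `f α` out
of the image of `ad e`. -/
lemma killingForm_principal_f_ne_zero {α : H.root} (hα : α ∈ b.support) :
    killingForm K L (v.principal b) (v.f α) ≠ 0 := by
  rw [principal, map_sum, LinearMap.sum_apply, Finset.sum_eq_single_of_mem α hα]
  · intro h0
    have h := lie_eq_killingForm_smul_of_mem_rootSpace_of_mem_rootSpace_neg (v.e_mem α) (v.f_mem α)
    rw [h0, zero_smul, (v.isSl2Triple α).lie_e_f] at h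
    exact (v.isSl2Triple α).h_ne_zero h
  · intro β _ hne
    refine killingForm_apply_eq_zero_of_mem_rootSpace_of_add_ne_zero K L H (v.e_mem β) (v.f_mem α)
      fun h ↦ hne ?_
    exact Subtype.ext (DFunLike.coe_injective (add_neg_eq_zero.mp h))

/-- Bracketing a negative root vector with a simple root vector raises the root, possibly to zero. -/
lemma lie_e_f_mem {J : Set H.root} {α β : H.root} 
    (hJ : ∀ δ : H.root, (rootSystem H).root δ = (rootSystem H).root β - (rootSystem H).root α →
      δ ∈ J) :
    ⁅v.e α, v.f β⁆ ∈ H.toSubmodule ⊔ Submodule.span K (v.f '' J) := by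
  have h : ⁅v.e α, v.f β⁆ ∈ rootSpace H ((α : Weight K H L) + -(β : Weight K H L) : H → K) :=
    lie_mem_genWeightSpace_of_mem_genWeightSpace (v.e_mem α) (v.f_mem β)
  by_cases hbot : rootSpace H ((α : Weight K H L) + -(β : Weight K H L) : H → K) = ⊥
  · rw [hbot, LieSubmodule.mem_bot] at h
    rw [h]
    exact zero_mem _
  let W : Weight K H L := ⟨_, hbot⟩
  by_cases hW0 : W.IsZero
  · have h0 : ((α : Weight K H L) + -(β : Weight K H L) : H → K) = 0 := hW0
    rw [h0] at h
    rw [rootSpace_zero_eq] at h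
    exact Submodule.mem_sup_left h
  · let δ : H.root := ⟨-W, by simpa [LieSubalgebra.root] using hW0⟩
    have hδ : (rootSystem H).root δ = (rootSystem H).root β - (rootSystem H).root α := by
      ext x
      simp [W, δ]
      ring
    refine Submodule.mem_sup_right ?_
    have hδW : (-(δ : Weight K H L) : H → K) = (α : Weight K H L) + -(β : Weight K H L) := by
      simp [δ, W]
    rw [← hδW] at h
    have h1 := finrank_rootSpace_eq_one (-(δ : Weight K H L)) (H.isNonZero_coe_root δ).neg
    obtain ⟨c, hc⟩ := (finrank_eq_one_iff_of_nonzero'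
      (⟨v.f δ, v.f_mem δ⟩ : rootSpace H (-(δ : Weight K H L) : Weight K H L))
      (by simpa using (v.isSl2Triple δ).f_ne_zero)).mp h1 ⟨_, h⟩
    have hc' : c • v.f δ = ⁅v.e α, v.f β⁆ := congr_arg Subtype.val hc
    rw [← hc']
    exact Submodule.smul_mem _ _ (Submodule.subset_span ⟨δ, hJ δ hδ, rfl⟩)

end RootVectors

end LieAlgebra.IsKilling

/-! ### The dimension count for antichains of maximal size. -/

namespace LieAlgebra.IsKilling

open LieModule Module RootPoset

variable {K L : Type*} [Field K] [CharZero K] [LieRing L] [LieAlgebra K L]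
  [IsKilling K L] [FiniteDimensional K L]
  {H : LieSubalgebra K L} [H.IsCartanSubalgebra] [IsTriangularizable K H L]
  {b : (rootSystem H).Base}

/-- If `Γ` is an antichain of positive roots and `J` consists of the positive roots which do not lie
strictly above an element of `Γ`, then bracketing with the principal nilpotent element maps the sum
of the root spaces of `-J` into the sum of `H` and the root spaces of `-(J \ Γ)`. -/
lemma RootVectors.lie_principal_f_mem (v : RootVectors H) {Γ J : Finset H.root} [DecidableEq H.root]
    (hJ : ∀ β, β ∈ J ↔ b.IsPos β ∧ ∀ γ ∈ Γ, rootLE b γ β → γ = β) {β : H.root} (hβ : β ∈ J) :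
    ⁅v.principal b, v.f β⁆ ∈
      H.toSubmodule ⊔ Submodule.span K (v.f '' (J \ Γ : Finset H.root)) := by
  rw [principal, sum_lie]
  refine sum_mem fun α hα ↦ v.lie_e_f_mem fun δ hδ ↦ ?_
  rw [hJ] at hβ
  -- If `γ ≼ δ = β - α`, then `γ ≼ β`, so `γ = β` by the choice of `J`; but `δ` has height one less
  -- than `β`.
  have hδβ (γ : H.root) (hγ : γ ∈ Γ) : ¬ rootLE b γ δ := by
    intro hle
    have hle' : rootLE b γ β := by
      have := add_mem hle (AddSubmonoid.subset_closure (Set.mem_image_of_mem _ hα))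
      rwa [hδ, sub_right_comm, sub_add_cancel] at this
    obtain rfl := hβ.2 γ hγ hle'
    have h1 := hle.height_le_and.1
    rw [b.height_sub hδ, RootPairing.Base.height_one_of_mem_support hα] at h1
    lia
  rw [Finset.mem_coe, Finset.mem_sdiff, hJ]
  refine ⟨⟨hβ.1.sub hα hδ, fun γ hγ hle ↦ (hδβ γ hγ hle).elim⟩, fun h ↦ hδβ δ h ?_⟩
  rw [rootLE, sub_self]
  exact zero_mem _

lemma card_support_eq_finrank (b : (rootSystem H).Base) : b.support.card = finrank K H := by
  rw [finrank_eq_card_basis b.toCoweightBasis, Fintype.card_coe]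

/-- An antichain of positive roots whose cardinality is the rank consists of the simple roots. -/
theorem eq_support_of_isAntichain {Γ : Finset H.root} (hpos : ∀ γ ∈ Γ, b.IsPos γ)
    (hanti : IsAntichain (rootLE b) (Γ : Set H.root)) (hcard : Γ.card = finrank K H) :
    Γ = b.support := by
  classical
  obtain ⟨v⟩ := nonempty_rootVectors (H := H)
  let J : Finset H.root := {β | b.IsPos β ∧ ∀ γ ∈ Γ, rootLE b γ β → γ = β}
  have hJ (β : H.root) : β ∈ J ↔ b.IsPos β ∧ ∀ γ ∈ Γ, rootLE b γ β → γ = β := by simp [J]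
  have hΓJ : Γ ⊆ J := fun β hβ ↦ (hJ β).mpr
    ⟨hpos β hβ, fun γ hγ hle ↦ by_contra fun hne ↦ hanti hγ hβ hne hle⟩
  let T : Submodule K L := H.toSubmodule ⊔ Submodule.span K (v.f '' (J \ Γ : Finset H.root))
  have hT : finrank K T ≤ J.card := by
    have h1 := Submodule.finrank_add_le_finrank_add_finrank H.toSubmodule
      (Submodule.span K (v.f '' (J \ Γ : Finset H.root)))
    have h2 : finrank K (Submodule.span K (v.f '' (J \ Γ : Finset H.root))) ≤ (J \ Γ).card := by
      rw [← Finset.coe_image]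
      exact (finrank_span_finset_le_card _).trans Finset.card_image_le
    have h3 := Finset.card_sdiff_add_card_eq_card hΓJ
    have h4 : finrank K H.toSubmodule = Γ.card := hcard.symm
    change finrank K T ≤ _ at h1
    lia
  let φ : (J → K) →ₗ[K] L :=
    ad K L (v.principal b) ∘ₗ Fintype.linearCombination K fun β : J ↦ v.f β
  have hφ (c : J → K) : φ c = ⁅v.principal b, ∑ β : J, c β • v.f β⁆ := by
    rw [LinearMap.comp_apply, ad_apply, Fintype.linearCombination_apply]
  have hinj : Function.Injective φ := by
    rw [injective_iff_map_eq_zero]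
    intro c hc
    let c' (β : H.root) : K := if h : β ∈ J then c ⟨β, h⟩ else 0
    have hc' (β : J) : c' β = c β := by simp [c']
    simp_rw [hφ, ← hc'] at hc
    rw [Finset.sum_coe_sort J fun β ↦ c' β • v.f β] at hc
    ext β
    rw [← hc']
    exact v.eq_zero_of_lie_principal_sum_eq_zero b (fun β hβ ↦ ((hJ β).mp hβ).1) c' hc β β.2
  have hle : LinearMap.range φ ≤ T := by
    rintro - ⟨c, rfl⟩
    rw [hφ, lie_sum]
    refine sum_mem fun β _ ↦ ?_
    rw [lie_smul]
    exact Submodule.smul_mem _ _ (v.lie_principal_f_mem hJ β.2)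
  have hrange : LinearMap.range φ = T := by
    refine Submodule.eq_of_le_of_finrank_le hle (hT.trans ?_)
    rw [LinearMap.finrank_range_of_inj hinj, finrank_fintype_fun_eq_card, Fintype.card_coe]
  have hsub : b.support ⊆ Γ := by
    intro α hα
    by_contra hαΓ
    have hαJ : α ∈ J := (hJ α).mpr ⟨RootPairing.Base.isPos_of_mem_support hα,
      fun γ hγ hle ↦ hle.eq_of_mem_support (hpos γ hγ) hα⟩
    have hαT : v.f α ∈ T := Submodule.mem_sup_right
      (Submodule.subset_span (Set.mem_image_of_mem _ (by simp [hαJ, hαΓ])))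
    rw [← hrange] at hαT
    obtain ⟨c, hc⟩ := hαT
    refine v.killingForm_principal_f_ne_zero b hα ?_
    -- By invariance, `κ(e, [e, z]) = κ([e, e], z) = 0`.
    rw [← hc, hφ, ← traceForm_apply_lie_apply, lie_self, map_zero, LinearMap.zero_apply]
  exact (Finset.eq_of_subset_of_card_le hsub (by rw [hcard, card_support_eq_finrank])).symm

end LieAlgebra.IsKilling

open LieAlgebra LieAlgebra.IsKilling LieModule in
theorem proposition2p8 {K L : Type*} [Field K] [CharZero K]
    [LieRing L] [LieAlgebra K L] [FiniteDimensional K L] [IsSimple K L]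
    (H : LieSubalgebra K L) [H.IsCartanSubalgebra] [IsTriangularizable K H L]
    (b : (rootSystem H).Base)
    (Γ : Finset H.root)
    (hpos : ∀ γ ∈ Γ, b.IsPos γ)
    (hanti : IsAntichain (RootPoset.rootLE b) (Γ : Set H.root)) :
    LinearIndepOn K (rootSystem H).root (Γ : Set H.root) ∧
      Γ.card ≤ Module.finrank K H ∧
      (Γ.card = Module.finrank K H → Γ = b.support) := by
  have hli : LinearIndepOn K (rootSystem H).root (Γ : Set H.root) :=
    RootPairing.Base.linearIndepOn_root_of_pairwise_nonpos hpos
      (RootPoset.pairingIn_nonpos_of_isAntichain hanti)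
  refine ⟨hli, ?_, eq_support_of_isAntichain hpos hanti⟩
  have h := LinearIndependent.fintype_card_le_finrank hli
  rw [Subspace.dual_finrank_eq] at h
  simpa using h
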